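/- Let $\mathbb N=\{0,1,2,\ldots\}$. (i) Let $\lambda\in\{1,2\}$ and $m\in\{2,3\}$. Then every $n\in\mathbb N$ can be written as $n=x^2+y^2+z^2+w^2$ with $x,y,z,w\in\mathbb Z$ such that $x+2y+3z-w=\lambda r^m$ for some $r\in\mathbb N$. (ii) Every $n\in\mathbb N$ can be written as $n=w^2+x^2+y^2+z^2$ with $w,x,y,z\in\mathbb Z$ such that $w(x+2y+3z-w)=0$, and hence such that $w(x+2y+3z)$ is the square of an integer. (iii) For every $n\in\mathbb N$ there are $w,x,y,z\in\mathbb Z$ with $w^2+x^2+y^2+z^2=n$ such that $(2w+x)(2w+x-y-3z)=0$, and hence such that $(10w+5x)^2+(12y+36z)^2$ is the square of an integer. -/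

import Mathlib

/-!
Three facts carry the argument.

The three-square theorem (`isSumThreeSq_or_exists`, `isSumThreeSq_of_mod`): a natural number that is
not of the form `4 ^ a * (8 * b + 7)` is a sum of three squares. A positive definite ternary form of
determinant one takes only such values (`isSumThreeSq_ternary_form`), and a form of this kind
representing `n` exists as soon as `-d` is a square modulo `d * n - 1` for some `d > 0`
(`isSumThreeSq_of_dvd_sq_add`). Dirichlet's theorem on primes in arithmetic progressions and
quadratic reciprocity supply such a `d`.

The form `x + 2 * y + 3 * z - w` is the real part of the product of a quaternion of norm `15` with
`x + y * i + z * j + w * k`. Hence a representation of `N` as a sum of four squares on which the form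
takes the value `s` gives `15 * N = s ^ 2 + t ^ 2 + u ^ 2 + v ^ 2`. Conversely, any such equation
comes from a representation of this kind after permuting `t`, `u`, `v` and changing their signs
(`exists_four_sq_linear_eq`). So the value `s` is attained whenever `15 * N - s ^ 2` is a sum of
three squares.

A sum of three squares `5 * n` yields `n = 5 * x ^ 2 + y ^ 2 + z ^ 2`
(`IsSumThreeSq.exists_five_mul_sq`).

The rest is a choice of `s`. If `15 * n` is a sum of three squares then `s = 0` works. Otherwise
`15 * n = 4 ^ a * (8 * b + 7)`: for `a < m` one may take `s = l * 1 ^ m` or `s = l * 2 ^ m`, and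
larger `a` reduce to smaller ones by scaling. For the products of two linear forms,
`w = 0` or `2 * w + x = 0` covers the `n` left over by `s = 0`, the second product using
the same form of norm `15` with its variables renamed.
-/

/-- `n` is a sum of three integer squares. -/
def IsSumThreeSq (n : ℤ) : Prop :=
  ∃ x y z : ℤ, n = x ^ 2 + y ^ 2 + z ^ 2

/-! ### Reduction of ternary quadratic forms of determinant one -/

lemma exists_abs_two_mul_add_mul_le {a : ℤ} (ha : 0 < a) (f : ℤ) :
    ∃ k : ℤ, |2 * (f + k * a)| ≤ a := by
  have h1 := Int.mul_ediv_add_emod (2 * f + a) (2 * a)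
  have h2 := Int.emod_nonneg (2 * f + a) (by omega : (2 * a) ≠ 0)
  have h3 := Int.emod_lt_of_pos (2 * f + a) (by omega : 0 < 2 * a)
  refine ⟨-((2 * f + a) / (2 * a)), ?_⟩
  rw [abs_le]
  constructor <;> linarith

/-- A reduced form of determinant one has `a = 1` and `a * b - f ^ 2 = 1`. Here `g` stands for
`a * b - f ^ 2`, and `h`, `i` complete the Gram matrix `!![g, h; h, i]` of determinant `a`. -/
lemma eq_one_of_reduced {a b f g h i : ℤ} (ha : 0 < a) (hg : 0 < g) (hf : |2 * f| ≤ a)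
    (hab : a ≤ b) (hgf : a * b - f ^ 2 = g) (hh : |2 * h| ≤ g) (hgi : g ≤ i)
    (hdet : g * i - h ^ 2 = a) : a = 1 ∧ g = 1 := by
  have hf2 : (2 * f) ^ 2 ≤ a ^ 2 := sq_le_sq' (by linarith [abs_le.1 hf]) (abs_le.1 hf).2
  have hh2 : (2 * h) ^ 2 ≤ g ^ 2 := sq_le_sq' (by linarith [abs_le.1 hh]) (abs_le.1 hh).2
  have h1 : 3 * a ^ 2 ≤ 4 * g := by nlinarith
  have h2 : 3 * g ^ 2 ≤ 4 * a := by nlinarith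
  have ha1 : a ≤ 1 := by
    by_contra! hlt
    nlinarith
  have hg1 : g ≤ 1 := by nlinarith
  omega

/-- A positive definite integral ternary form of determinant one takes only values that are sums
of three squares. By Hermite reduction: as long as the form is not reduced, exchanging two
variables decreases one of `a` and `a * b - f ^ 2` and keeps the other; a reduced form is
`(x + e * z) ^ 2 + y ^ 2 + z ^ 2`. -/
theorem isSumThreeSq_ternary_form (N : ℕ) : ∀ a b c d e f : ℤ, 0 < a → 0 < a * b - f ^ 2 →
    a * b * c + 2 * d * e * f - a * d ^ 2 - b * e ^ 2 - c * f ^ 2 = 1 →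
    a + (a * b - f ^ 2) = N → ∀ x y z : ℤ, IsSumThreeSq
      (a * x ^ 2 + b * y ^ 2 + c * z ^ 2 + 2 * d * y * z + 2 * e * x * z + 2 * f * x * y) := by
  induction N using Nat.strong_induction_on with
  | _ N ih =>
  intro a b c d e f ha hg hdet hN x y z
  -- Translating `x` by a multiple of `y` gives `|2 * f₁| ≤ a`.
  obtain ⟨k, hk⟩ := exists_abs_two_mul_add_mul_le ha f
  obtain ⟨f₁, hf₁⟩ : ∃ f₁, f₁ = f + k * a := ⟨_, rfl⟩
  obtain ⟨b₁, hb₁⟩ : ∃ b₁, b₁ = b + 2 * k * f + k ^ 2 * a := ⟨_, rfl⟩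
  obtain ⟨d₁, hd₁⟩ : ∃ d₁, d₁ = d + k * e := ⟨_, rfl⟩
  rw [← hf₁] at hk
  have hg₁ : a * b₁ - f₁ ^ 2 = a * b - f ^ 2 := by subst f₁ b₁; ring
  have hdet₁ : a * b₁ * c + 2 * d₁ * e * f₁ - a * d₁ ^ 2 - b₁ * e ^ 2 - c * f₁ ^ 2 = 1 := by
    rw [← hdet]; subst f₁ b₁ d₁; ring
  have hb₁pos : 0 < b₁ := by
    have : 0 < a * b₁ := by nlinarith [sq_nonneg f₁]
    exact pos_of_mul_pos_right this ha.le
  rcases lt_or_ge b₁ a with hlt | hab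
  · have := ih (b₁ + (a * b - f ^ 2)).toNat (by omega) b₁ a c e d₁ f₁ hb₁pos
      (by linarith) (by linarith) (by rw [Int.toNat_of_nonneg (by omega)]; linarith)
      y (x - k * y) z
    convert this using 1
    subst f₁ b₁ d₁; ring
  -- Translating `y` by a multiple of `z` does the same for the binary form in `y` and `z`.
  obtain ⟨g, hgdef⟩ : ∃ g, g = a * b₁ - f₁ ^ 2 := ⟨_, rfl⟩
  have hgpos : 0 < g := by linarith
  obtain ⟨l, hl⟩ := exists_abs_two_mul_add_mul_le hgpos (a * d₁ - e * f₁)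
  obtain ⟨d₂, hd₂⟩ : ∃ d₂, d₂ = d₁ + l * b₁ := ⟨_, rfl⟩
  obtain ⟨e₂, he₂⟩ : ∃ e₂, e₂ = e + l * f₁ := ⟨_, rfl⟩
  obtain ⟨c₂, hc₂⟩ : ∃ c₂, c₂ = c + 2 * l * d₁ + l ^ 2 * b₁ := ⟨_, rfl⟩
  have hl' : a * d₁ - e * f₁ + l * g = a * d₂ - e₂ * f₁ := by subst g d₂ e₂; ring
  rw [hl'] at hl
  have hdet₂ : a * b₁ * c₂ + 2 * d₂ * e₂ * f₁ - a * d₂ ^ 2 - b₁ * e₂ ^ 2 - c₂ * f₁ ^ 2 = 1 := by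
    rw [← hdet₁]; subst d₂ e₂ c₂; ring
  have hgi : g * (a * c₂ - e₂ ^ 2) - (a * d₂ - e₂ * f₁) ^ 2 = a := by
    rw [hgdef]; linear_combination a * hdet₂
  have hipos : 0 < a * c₂ - e₂ ^ 2 := by
    have : 0 < g * (a * c₂ - e₂ ^ 2) := by nlinarith [sq_nonneg (a * d₂ - e₂ * f₁)]
    exact pos_of_mul_pos_right this hgpos.le
  have hval : a * x ^ 2 + b * y ^ 2 + c * z ^ 2 + 2 * d * y * z + 2 * e * x * z + 2 * f * x * y =
      a * (x - k * y) ^ 2 + b₁ * (y - l * z) ^ 2 + c₂ * z ^ 2 + 2 * d₂ * (y - l * z) * z +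
        2 * e₂ * (x - k * y) * z + 2 * f₁ * (x - k * y) * (y - l * z) := by
    subst d₂ e₂ c₂ f₁ b₁ d₁; ring
  rcases lt_or_ge (a * c₂ - e₂ ^ 2) g with hlt | hle
  · have := ih (a + (a * c₂ - e₂ ^ 2)).toNat (by omega) a c₂ b₁ d₂ f₁ e₂ ha hipos
      (by linarith) (by rw [Int.toNat_of_nonneg (by omega)]) (x - k * y) z (y - l * z)
    rw [hval]
    convert this using 1
    ring
  obtain ⟨ha1, hg1⟩ := eq_one_of_reduced ha hgpos hk hab hgdef.symm hl hle hgi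
  rw [hg1, ha1] at hgi
  rw [ha1] at hk hgdef hl
  rw [hg1] at hl hgdef
  have hf0 : f₁ = 0 := by rw [abs_le] at hk; omega
  have hh0 : 1 * d₂ - e₂ * f₁ = 0 := by rw [abs_le] at hl; omega
  rw [hh0] at hgi
  rw [hf0] at hgdef hh0
  have hb1 : b₁ = 1 := by linarith
  have hd0 : d₂ = 0 := by linarith
  have hc : c₂ = 1 + e₂ ^ 2 := by linarith
  refine ⟨x - k * y + e₂ * z, y - l * z, z, ?_⟩
  rw [hval, ha1, hf0, hb1, hd0, hc]
  ring

/-- If `-d` is a square modulo `d * n - 1`, then `n` is a sum of three squares: it is the last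
diagonal entry of a positive definite matrix `!![a, k, 1; k, d * n - 1, 0; 1, 0, n]` of
determinant one. -/
theorem isSumThreeSq_of_dvd_sq_add {n d k : ℤ} (hd : 0 < d) (hm : 0 < d * n - 1)
    (h : d * n - 1 ∣ k ^ 2 + d) : IsSumThreeSq n := by
  obtain ⟨a, ha⟩ := h
  have ha0 : 0 < a := by
    have : 0 < (d * n - 1) * a := by rw [← ha]; positivity
    exact pos_of_mul_pos_right this hm.le
  have hg : a * (d * n - 1) - k ^ 2 = d := by linarith
  have := isSumThreeSq_ternary_form (a + d).toNat a (d * n - 1) n 0 1 k ha0 (by omega)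
    (by linear_combination n * hg) (by rw [hg, Int.toNat_of_nonneg (by omega)]) 0 0 1
  simpa using this

/-! ### The three-square theorem -/

open scoped NumberTheorySymbols

lemma exists_dvd_sq_add_of_jacobiSym_neg {p d : ℕ} [Fact p.Prime] (h : J(-(d : ℤ) | p) = 1) :
    ∃ k : ℤ, (p : ℤ) ∣ k ^ 2 + d := by
  obtain ⟨r, hr⟩ := ZMod.isSquare_of_jacobiSym_eq_one h
  refine ⟨r.val, (ZMod.intCast_zmod_eq_zero_iff_dvd _ _).1 ?_⟩
  push_cast at hr ⊢
  rw [ZMod.natCast_val, ZMod.cast_id, sq, ← hr]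
  ring

/-- A number `n ≡ 2 [MOD 4]` is a sum of three squares: for a prime `p = d * n - 1` with
`d ≡ 1 [MOD 4]`, reciprocity gives `J(-d | p) = J(p | d) = J(-1 | d) = 1`. -/
theorem isSumThreeSq_of_mod_four_eq_two {n : ℕ} (hn : n % 4 = 2) : IsSumThreeSq n := by
  have hcop : (n - 1).Coprime (4 * n) := by
    refine Nat.Coprime.mul_right ?_ ?_
    · rw [show 4 = 2 ^ 2 by norm_num]
      exact (Nat.coprime_two_right.2 (Nat.odd_iff.2 (by omega))).pow_right 2
    · exact (Nat.coprime_self_sub_left (by omega)).2 (Nat.coprime_one_left n)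
  obtain ⟨p, hpn, hp, hmod⟩ :=
    Nat.forall_exists_prime_gt_and_modEq n (q := 4 * n) (by omega) hcop
  obtain ⟨j, hj⟩ := (Nat.modEq_iff_dvd' (by omega)).1 hmod.symm
  have hpd : p + 1 = (4 * j + 1) * n := by
    have : (4 * j + 1) * n = 4 * n * j + n := by ring
    omega
  obtain ⟨d, hd⟩ : ∃ d, d = 4 * j + 1 := ⟨_, rfl⟩
  rw [← hd] at hpd
  have : Fact p.Prime := ⟨hp⟩
  have hp4 : p % 4 = 1 := by
    have : p = 4 * (n * j) + (n - 1) := by rw [← mul_assoc]; omega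
    omega
  have hdodd : Odd d := Nat.odd_iff.2 (by omega)
  have hpodd : Odd p := Nat.odd_iff.2 (by omega)
  have hpdZ : (p : ℤ) = d * n - 1 := by
    have : (p : ℤ) + 1 = d * n := by exact_mod_cast hpd
    linarith
  have hJ : J(-(d : ℤ) | p) = 1 := by
    rw [jacobiSym.neg _ hpodd, ZMod.χ₄_nat_one_mod_four hp4, one_mul,
      jacobiSym.quadratic_reciprocity_one_mod_four' hdodd hp4,
      jacobiSym.mod_left' (a₂ := -1) (by rw [hpdZ]; simp [sub_eq_add_neg]),
      jacobiSym.at_neg_one hdodd, ZMod.χ₄_nat_one_mod_four (by omega)]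
  obtain ⟨k, hk⟩ := exists_dvd_sq_add_of_jacobiSym_neg hJ
  refine isSumThreeSq_of_dvd_sq_add (d := d) (k := k) (by omega) ?_ (by rwa [← hpdZ])
  rw [← hpdZ]
  exact_mod_cast hp.pos

/-- An odd `n` with `n % 8 ≠ 7` is a sum of three squares: take a prime `p` with
`2 * p = d * n - 1`, where `d ≡ c [MOD 8]` with `c = 1` if `n ≡ 3 [MOD 8]` and `c = 3` otherwise,
so that `(c * n - 1) / 2` is odd and coprime to `4 * n`. Reciprocity determines `J(-d | p)` from
`J(2 | d) * J(p | d) = J(-1 | d)`. -/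
theorem isSumThreeSq_of_odd {n : ℕ} (hn : n % 8 = 1 ∨ n % 8 = 3 ∨ n % 8 = 5) :
    IsSumThreeSq n := by
  obtain ⟨c, hc⟩ : ∃ c : ℕ, (c = 3 ∧ (n % 8 = 1 ∨ n % 8 = 5)) ∨ (c = 1 ∧ n % 8 = 3) := by
    rcases hn with h | h | h
    exacts [⟨3, by omega⟩, ⟨1, by omega⟩, ⟨3, by omega⟩]
  obtain ⟨q, hq⟩ : ∃ q, c * n = 2 * q + 1 := by
    refine ⟨c * n / 2, ?_⟩
    rcases hc with ⟨rfl, _⟩ | ⟨rfl, _⟩ <;> omega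
  have hqodd : q % 2 = 1 := by rcases hc with ⟨rfl, _⟩ | ⟨rfl, _⟩ <;> omega
  have hcop : q.Coprime (4 * n) := by
    refine Nat.Coprime.mul_right ?_ ?_
    · rw [show 4 = 2 ^ 2 by norm_num]
      exact (Nat.coprime_two_right.2 (Nat.odd_iff.2 hqodd)).pow_right 2
    · rw [Nat.coprime_iff_isRelPrime]
      intro t htq htn
      have h1 : t ∣ 2 * q + 1 := hq ▸ htn.mul_left c
      exact isUnit_of_dvd_one ((Nat.dvd_add_right (htq.mul_left 2)).1 h1)
  obtain ⟨p, hpn, hp, hmod⟩ :=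
    Nat.forall_exists_prime_gt_and_modEq q (q := 4 * n) (by omega) hcop
  obtain ⟨j, hj⟩ := (Nat.modEq_iff_dvd' hpn.le).1 hmod.symm
  obtain ⟨d, hd⟩ : ∃ d, d = 8 * j + c := ⟨_, rfl⟩
  have hpd : 2 * p + 1 = d * n := by
    have h1 : d * n = 2 * (4 * n * j) + c * n := by rw [hd]; ring
    omega
  have : Fact p.Prime := ⟨hp⟩
  have hpq : p = 4 * (n * j) + q := by rw [← mul_assoc]; omega
  have hdodd : Odd d := Nat.odd_iff.2 (by omega)
  have hpodd : Odd p := Nat.odd_iff.2 (by omega)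
  have hpdZ : 2 * (p : ℤ) = d * n - 1 := by
    have : 2 * (p : ℤ) + 1 = d * n := by exact_mod_cast hpd
    linarith
  have h2p : J(2 | d) * J((p : ℤ) | d) = ZMod.χ₄ d := by
    rw [← jacobiSym.mul_left, ← jacobiSym.at_neg_one hdodd]
    exact jacobiSym.mod_left' (by rw [hpdZ]; simp [sub_eq_add_neg])
  rw [jacobiSym.at_two hdodd, ZMod.χ₈_nat_eq_if_mod_eight, if_neg (by omega)] at h2p
  have hJ : J(-(d : ℤ) | p) = 1 := by
    rw [jacobiSym.neg _ hpodd]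
    rcases hc with ⟨rfl, h | h⟩ | ⟨rfl, h⟩
    · have hp4 : p % 4 = 1 := by omega
      rw [if_neg (by omega), ZMod.χ₄_nat_three_mod_four (by omega)] at h2p
      rw [ZMod.χ₄_nat_one_mod_four hp4,
        jacobiSym.quadratic_reciprocity_one_mod_four' hdodd hp4]
      linarith
    · have hp4 : p % 4 = 3 := by omega
      rw [if_neg (by omega), ZMod.χ₄_nat_three_mod_four (by omega)] at h2p
      rw [ZMod.χ₄_nat_three_mod_four hp4,
        jacobiSym.quadratic_reciprocity_three_mod_four (by omega) hp4]
      linarith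
    · have hp4 : p % 4 = 1 := by omega
      rw [if_pos (by omega), ZMod.χ₄_nat_one_mod_four (by omega)] at h2p
      rw [ZMod.χ₄_nat_one_mod_four hp4,
        jacobiSym.quadratic_reciprocity_one_mod_four' hdodd hp4]
      linarith
  obtain ⟨k, hk⟩ := exists_dvd_sq_add_of_jacobiSym_neg hJ
  -- Adding `p` if necessary, `k` may be taken odd, so that `2 * p` divides `k ^ 2 + d`.
  obtain ⟨k', hk', hkodd⟩ : ∃ k' : ℤ, (p : ℤ) ∣ k' ^ 2 + d ∧ Odd k' := by
    rcases Int.even_or_odd k with he | ho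
    · refine ⟨k + p, ?_, he.add_odd (by exact_mod_cast hpodd)⟩
      rw [show (k + p : ℤ) ^ 2 + d = k ^ 2 + d + p * (2 * k + p) by ring]
      exact dvd_add hk (dvd_mul_right _ _)
    · exact ⟨k, hk, ho⟩
  have h2 : (2 : ℤ) ∣ k' ^ 2 + d :=
    (hkodd.pow.add_odd (by exact_mod_cast hdodd)).two_dvd
  refine isSumThreeSq_of_dvd_sq_add (d := d) (k := k') (by omega) ?_ ?_
  · rw [← hpdZ]
    have := hp.pos
    omega
  · rw [← hpdZ]
    refine IsCoprime.mul_dvd ?_ h2 hk'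
    exact_mod_cast Nat.isCoprime_iff_coprime.2 (Nat.coprime_two_left.2 hpodd)

lemma IsSumThreeSq.sq_mul {n : ℤ} (h : IsSumThreeSq n) (k : ℤ) : IsSumThreeSq (k ^ 2 * n) := by
  obtain ⟨x, y, z, rfl⟩ := h
  exact ⟨k * x, k * y, k * z, by ring⟩

/-- **Legendre's three-square theorem**, for numbers not divisible by four. -/
theorem isSumThreeSq_of_mod {n : ℤ} (h0 : 0 ≤ n) (h4 : n % 4 ≠ 0) (h8 : n % 8 ≠ 7) :
    IsSumThreeSq n := by
  lift n to ℕ using h0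
  by_cases h : n % 4 = 2
  · exact isSumThreeSq_of_mod_four_eq_two h
  · exact isSumThreeSq_of_odd (by omega)

/-- **Legendre's three-square theorem**: the exceptions are of the form `4 ^ a * (8 * b + 7)`. -/
theorem isSumThreeSq_or_exists (n : ℕ) :
    IsSumThreeSq n ∨ ∃ a b : ℕ, n = 4 ^ a * (8 * b + 7) := by
  induction n using Nat.strong_induction_on with
  | _ n ih =>
  rcases Nat.eq_zero_or_pos n with rfl | hpos
  · exact Or.inl ⟨0, 0, 0, by simp⟩
  by_cases h4 : n % 4 = 0
  · obtain ⟨m, rfl⟩ := Nat.dvd_of_mod_eq_zero h4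
    rcases ih m (by omega) with h | ⟨a, b, h⟩
    · left
      have := h.sq_mul 2
      push_cast
      norm_num at this
      exact this
    · exact Or.inr ⟨a + 1, b, by rw [h]; ring⟩
  · by_cases h8 : n % 8 = 7
    · exact Or.inr ⟨0, n / 8, by omega⟩
    · exact Or.inl (isSumThreeSq_of_mod (by omega) (by omega) (by omega))

/-! ### Four squares with a prescribed value of a linear form of norm fifteen -/

/-- The witnesses are the components of the quaternion
`(1 + 2 * i + 3 * j - k) * (s + t * i + u * j + v * k) / 15`. -/
lemma exists_four_sq_of_congr {N s t u v : ℤ} (h : s ^ 2 + t ^ 2 + u ^ 2 + v ^ 2 = 15 * N)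
    (ht : 5 ∣ t - 3 * s) (hv : 5 ∣ v - 3 * u) (h3u : 3 ∣ u - (s - t)) (h3v : 3 ∣ v + s + t) :
    ∃ x y z w : ℤ, N = x ^ 2 + y ^ 2 + z ^ 2 + w ^ 2 ∧ x + 2 * y + 3 * z - w = s := by
  obtain ⟨x, hx⟩ : (15 : ℤ) ∣ s - 2 * t - 3 * u + v := by omega
  obtain ⟨y, hy⟩ : (15 : ℤ) ∣ t + 2 * s + 3 * v + u := by omega
  obtain ⟨z, hz⟩ : (15 : ℤ) ∣ u - 2 * v + 3 * s - t := by omega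
  obtain ⟨w, hw⟩ : (15 : ℤ) ∣ v + 2 * u - 3 * t - s := by omega
  refine ⟨x, y, z, w, ?_, by omega⟩
  have key : (15 * x) ^ 2 + (15 * y) ^ 2 + (15 * z) ^ 2 + (15 * w) ^ 2 = 15 * (15 * N) := by
    rw [← hx, ← hy, ← hz, ← hw, ← h]; ring
  linarith

lemma zmod_three_rotation : ∀ s t u v : ZMod 3, s ^ 2 + t ^ 2 + u ^ 2 + v ^ 2 = 0 →
    (u = s - t ∧ v = -s - t) ∨ (-u = s - t ∧ -v = -s - t) ∨
      (v = s - t ∧ -u = -s - t) ∨ (-v = s - t ∧ u = -s - t) := by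
  decide

set_option maxRecDepth 4000 in
lemma zmod_five_sq_add_sq : ∀ s t u v : ZMod 5, s ^ 2 + t ^ 2 + u ^ 2 + v ^ 2 = 0 →
    s ^ 2 + t ^ 2 = 0 ∨ s ^ 2 + u ^ 2 = 0 ∨ s ^ 2 + v ^ 2 = 0 := by
  decide

/-- The rotations `(u, v) ↦ (v, -u)` preserve `v ≡ 3 * u [ZMOD 5]`, and one of them achieves the
congruences modulo three. -/
lemma exists_four_sq_of_congr_five {N s t u v : ℤ}
    (h : s ^ 2 + t ^ 2 + u ^ 2 + v ^ 2 = 15 * N) (ht : 5 ∣ t - 3 * s) (hv : 5 ∣ v - 3 * u) :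
    ∃ x y z w : ℤ, N = x ^ 2 + y ^ 2 + z ^ 2 + w ^ 2 ∧ x + 2 * y + 3 * z - w = s := by
  have h3 : (s : ZMod 3) ^ 2 + (t : ZMod 3) ^ 2 + (u : ZMod 3) ^ 2 + (v : ZMod 3) ^ 2 = 0 := by
    exact_mod_cast (ZMod.intCast_zmod_eq_zero_iff_dvd _ 3).2 ⟨5 * N, by rw [h]; push_cast; ring⟩
  have dvd_of_eq : ∀ a b : ℤ, (a : ZMod 3) = (b : ZMod 3) → 3 ∣ a - b := fun a b hab => by
    refine (ZMod.intCast_zmod_eq_zero_iff_dvd _ 3).1 ?_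
    push_cast
    rw [hab, sub_self]
  rcases zmod_three_rotation _ _ _ _ h3 with ⟨h1, h2⟩ | ⟨h1, h2⟩ | ⟨h1, h2⟩ | ⟨h1, h2⟩
  · have h1 := dvd_of_eq u (s - t) (by exact_mod_cast h1)
    have h2 := dvd_of_eq v (-s - t) (by exact_mod_cast h2)
    exact exists_four_sq_of_congr (u := u) (v := v) (by linarith) ht
      (by omega) (by omega) (by omega)
  · have h1 := dvd_of_eq (-u) (s - t) (by exact_mod_cast h1)
    have h2 := dvd_of_eq (-v) (-s - t) (by exact_mod_cast h2)
    exact exists_four_sq_of_congr (u := -u) (v := -v) (by linarith) ht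
      (by omega) (by omega) (by omega)
  · have h1 := dvd_of_eq v (s - t) (by exact_mod_cast h1)
    have h2 := dvd_of_eq (-u) (-s - t) (by exact_mod_cast h2)
    exact exists_four_sq_of_congr (u := v) (v := -u) (by linarith) ht
      (by omega) (by omega) (by omega)
  · have h1 := dvd_of_eq (-v) (s - t) (by exact_mod_cast h1)
    have h2 := dvd_of_eq u (-s - t) (by exact_mod_cast h2)
    exact exists_four_sq_of_congr (u := -v) (v := u) (by linarith) ht
      (by omega) (by omega) (by omega)

lemma prime_five_int : Prime (5 : ℤ) := Nat.prime_iff_prime_int.1 Nat.prime_five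

lemma dvd_sub_or_dvd_add_of_five_dvd {s t : ℤ} (h : 5 ∣ s ^ 2 + t ^ 2) :
    5 ∣ t - 3 * s ∨ 5 ∣ t + 3 * s := by
  refine prime_five_int.dvd_or_dvd ?_
  rw [show (t - 3 * s) * (t + 3 * s) = s ^ 2 + t ^ 2 - 5 * (2 * s ^ 2) by ring]
  exact dvd_sub h (dvd_mul_right _ _)

/-- A representation of `15 * N` as a sum of four squares descends to one of `N` in which the
first root becomes the value of `x + 2 * y + 3 * z - w`. -/
theorem exists_four_sq_linear_eq {N s t u v : ℤ}
    (h : s ^ 2 + t ^ 2 + u ^ 2 + v ^ 2 = 15 * N) :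
    ∃ x y z w : ℤ, N = x ^ 2 + y ^ 2 + z ^ 2 + w ^ 2 ∧ x + 2 * y + 3 * z - w = s := by
  wlog h5 : 5 ∣ s ^ 2 + t ^ 2 generalizing t u v
  · have h0 : (s : ZMod 5) ^ 2 + (t : ZMod 5) ^ 2 + (u : ZMod 5) ^ 2 + (v : ZMod 5) ^ 2 = 0 := by
      exact_mod_cast (ZMod.intCast_zmod_eq_zero_iff_dvd _ 5).2
        ⟨3 * N, by rw [h]; push_cast; ring⟩
    have dvd_of_eq : ∀ a b : ℤ, (a : ZMod 5) ^ 2 + (b : ZMod 5) ^ 2 = 0 → 5 ∣ a ^ 2 + b ^ 2 :=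
      fun a b hab => (ZMod.intCast_zmod_eq_zero_iff_dvd _ 5).1 (by exact_mod_cast hab)
    rcases zmod_five_sq_add_sq _ _ _ _ h0 with h1 | h1 | h1
    · exact absurd (dvd_of_eq _ _ h1) h5
    · exact this (t := u) (u := t) (v := v) (by linarith) (dvd_of_eq _ _ h1)
    · exact this (t := v) (u := u) (v := t) (by linarith) (dvd_of_eq _ _ h1)
  have h5' : 5 ∣ u ^ 2 + v ^ 2 := by omega
  rcases dvd_sub_or_dvd_add_of_five_dvd h5 with ht | ht <;>
    rcases dvd_sub_or_dvd_add_of_five_dvd h5' with hv | hv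
  · exact exists_four_sq_of_congr_five h ht hv
  · exact exists_four_sq_of_congr_five (u := -u) (v := v) (by linarith) ht (by omega)
  · exact exists_four_sq_of_congr_five (t := -t) (by linarith) (by omega) hv
  · exact exists_four_sq_of_congr_five (t := -t) (u := -u) (v := v) (by linarith)
      (by omega) (by omega)

lemma IsSumThreeSq.exists_linear_eq {N s : ℤ} (h : IsSumThreeSq (15 * N - s ^ 2)) :
    ∃ x y z w : ℤ, N = x ^ 2 + y ^ 2 + z ^ 2 + w ^ 2 ∧ x + 2 * y + 3 * z - w = s := by
  obtain ⟨t, u, v, htuv⟩ := h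
  exact exists_four_sq_linear_eq (t := t) (u := u) (v := v) (by linarith)

/-- If `15 * n = 4 ^ a * (8 * b + 7)` with `a < m`, then `15 * n - (l * r ^ m) ^ 2` is a sum of
three squares for `r = 1` or, when `a = 2` and `l = 1`, for `r = 2`. -/
lemma exists_isSumThreeSq_sub_sq {l : ℤ} (hl : l = 1 ∨ l = 2) {m : ℕ} (hm : m = 2 ∨ m = 3)
    {n : ℤ} {a b : ℕ} (ham : a < m) (h : 15 * n = 4 ^ a * (8 * b + 7)) :
    ∃ r : ℕ, IsSumThreeSq (15 * n - (l * (r : ℤ) ^ m) ^ 2) := by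
  have ha : a = 0 ∨ a = 1 ∨ a = 2 ∧ m = 3 := by omega
  rcases ha with rfl | rfl | ⟨rfl, rfl⟩
  · refine ⟨1, ?_⟩
    rw [h]
    apply isSumThreeSq_of_mod <;> rcases hl with rfl | rfl <;> norm_num <;> omega
  · refine ⟨1, ?_⟩
    rw [h]
    rcases hl with rfl | rfl
    · apply isSumThreeSq_of_mod <;> norm_num <;> omega
    · have h1 : IsSumThreeSq (8 * b + 6) := isSumThreeSq_of_mod (by omega) (by omega) (by omega)
      convert h1.sq_mul 2 using 1
      push_cast; ring
  · rw [h]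
    rcases hl with rfl | rfl
    · refine ⟨2, ?_⟩
      have h1 : IsSumThreeSq (8 * b + 3) := isSumThreeSq_of_mod (by omega) (by omega) (by omega)
      convert h1.sq_mul 4 using 1
      push_cast; ring
    · refine ⟨1, ?_⟩
      have h1 : IsSumThreeSq (4 * (8 * b + 7) - 1) :=
        isSumThreeSq_of_mod (by omega) (by omega) (by omega)
      convert h1.sq_mul 2 using 1
      push_cast; ring

theorem exists_four_sq_linear_eq_mul_pow {l : ℤ} (hl : l = 1 ∨ l = 2) {m : ℕ}
    (hm : m = 2 ∨ m = 3) (n : ℕ) : ∃ x y z w : ℤ, (n : ℤ) = x ^ 2 + y ^ 2 + z ^ 2 + w ^ 2 ∧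
      ∃ r : ℕ, x + 2 * y + 3 * z - w = l * (r : ℤ) ^ m := by
  induction n using Nat.strong_induction_on with
  | _ n ih =>
  rcases isSumThreeSq_or_exists (15 * n) with h | ⟨a, b, h⟩
  · obtain ⟨x, y, z, w, hn, hL⟩ := IsSumThreeSq.exists_linear_eq (N := n) (s := 0)
      (by simpa using h)
    exact ⟨x, y, z, w, hn, 0, by rcases hm with rfl | rfl <;> simpa using hL⟩
  have hpos : 0 < n := by
    have : 0 < 4 ^ a * (8 * b + 7) := by positivity
    omega
  rcases lt_or_ge a m with ham | ham
  · obtain ⟨r, hr⟩ := exists_isSumThreeSq_sub_sq hl hm (n := n) ham (by exact_mod_cast h)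
    obtain ⟨x, y, z, w, hn, hL⟩ := hr.exists_linear_eq
    exact ⟨x, y, z, w, hn, r, hL⟩
  · -- Here `4 ^ m ∣ n`, and scaling all variables by `2 ^ m` replaces `r` by `2 * r`.
    have hdvd : 4 ^ m ∣ n := by
      have h1 : 4 ^ m ∣ 15 * n := h ▸ (pow_dvd_pow 4 ham).mul_right _
      exact (Nat.Coprime.pow_left m (by norm_num)).dvd_of_dvd_mul_left h1
    obtain ⟨k, rfl⟩ := hdvd
    have hk : k < 4 ^ m * k := by
      have h1 : 1 < 4 ^ m := Nat.one_lt_pow (by omega) (by norm_num)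
      have h2 : 0 < k := Nat.pos_of_mul_pos_left hpos
      nlinarith
    obtain ⟨x, y, z, w, hn, r, hL⟩ := ih k hk
    refine ⟨2 ^ m * x, 2 ^ m * y, 2 ^ m * z, 2 ^ m * w, ?_, 2 * r, ?_⟩
    · push_cast
      rw [hn, show (4 : ℤ) = 2 ^ 2 by norm_num, ← pow_mul, mul_comm 2 m, pow_mul]
      ring
    · push_cast
      rw [mul_pow]
      linear_combination 2 ^ m * hL

/-! ### The products of two linear forms -/

theorem exists_four_sq_mul_eq_zero (n : ℕ) :
    ∃ w x y z : ℤ, (n : ℤ) = w ^ 2 + x ^ 2 + y ^ 2 + z ^ 2 ∧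
      w * (x + 2 * y + 3 * z - w) = 0 := by
  rcases isSumThreeSq_or_exists n with ⟨x, y, z, h⟩ | ⟨a, b, h⟩
  · exact ⟨0, x, y, z, by rw [h]; ring, by ring⟩
  have h15 : IsSumThreeSq (15 * n - 0 ^ 2) := by
    have h1 : IsSumThreeSq (15 * (8 * b + 7)) :=
      isSumThreeSq_of_mod (by omega) (by omega) (by omega)
    convert h1.sq_mul (2 ^ a) using 1
    rw [h, ← pow_mul, mul_comm a 2, pow_mul]
    push_cast; norm_num; ring
  obtain ⟨x, y, z, w, hn, hL⟩ := h15.exists_linear_eq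
  exact ⟨w, x, y, z, by rw [hn]; ring, by rw [hL, mul_zero]⟩

/-- A sum of three squares divisible by five is of the form `5 * (5 * x ^ 2 + y ^ 2 + z ^ 2)`: one
of the squares is divisible by `25`, and the sum of the other two is divided by `2 ^ 2 + 1 ^ 2`. -/
lemma IsSumThreeSq.exists_five_mul_sq {n : ℤ} (h : IsSumThreeSq (5 * n)) :
    ∃ x y z : ℤ, n = 5 * x ^ 2 + y ^ 2 + z ^ 2 := by
  obtain ⟨t, u, v, htuv⟩ := h
  wlog h5 : 5 ∣ t ^ 2 generalizing t u v
  · have h0 : ((0 : ℤ) : ZMod 5) ^ 2 + (t : ZMod 5) ^ 2 + (u : ZMod 5) ^ 2 + (v : ZMod 5) ^ 2 =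
        0 := by
      exact_mod_cast (ZMod.intCast_zmod_eq_zero_iff_dvd _ 5).2 ⟨n, by push_cast; linarith⟩
    have dvd_of_eq : ∀ a : ℤ, ((0 : ℤ) : ZMod 5) ^ 2 + (a : ZMod 5) ^ 2 = 0 → 5 ∣ a ^ 2 :=
      fun a ha => (ZMod.intCast_zmod_eq_zero_iff_dvd _ 5).1 (by
        rw [Int.cast_zero, zero_pow two_ne_zero, zero_add] at ha
        exact_mod_cast ha)
    rcases zmod_five_sq_add_sq _ _ _ _ h0 with h1 | h1 | h1
    · exact absurd (dvd_of_eq _ h1) h5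
    · exact this u t v (by linarith) (dvd_of_eq _ h1)
    · exact this v u t (by linarith) (dvd_of_eq _ h1)
  have h5' : 5 ∣ u ^ 2 + v ^ 2 := by omega
  obtain ⟨t, rfl⟩ := prime_five_int.dvd_of_dvd_pow h5
  wlog hv : 5 ∣ v - 3 * u generalizing u
  · refine this (-u) (by simpa using h5') (by linarith) ?_
    have := (dvd_sub_or_dvd_add_of_five_dvd h5').resolve_left hv
    omega
  obtain ⟨k, hk⟩ := hv
  obtain rfl : v = 5 * k + 3 * u := by linarith
  refine ⟨t, u + k, u + 2 * k, ?_⟩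
  linarith

theorem exists_four_sq_mul_eq_zero' (n : ℕ) :
    ∃ w x y z : ℤ, w ^ 2 + x ^ 2 + y ^ 2 + z ^ 2 = (n : ℤ) ∧
      (2 * w + x) * (2 * w + x - y - 3 * z) = 0 := by
  rcases isSumThreeSq_or_exists (15 * n) with h | ⟨a, b, h⟩
  · obtain ⟨x, y, z, w, hn, hL⟩ := IsSumThreeSq.exists_linear_eq (N := n) (s := 0)
      (by simpa using h)
    exact ⟨y, x, w, -z, by rw [hn]; ring, by linear_combination (2 * y + x) * hL⟩
  have h5 : IsSumThreeSq (5 * n) := by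
    have h3 : 3 ∣ 8 * b + 7 := by
      have h1 : 3 ∣ 4 ^ a * (8 * b + 7) := ⟨5 * n, by linarith⟩
      exact (Nat.Coprime.pow_right a (by norm_num : Nat.Coprime 3 4)).dvd_of_dvd_mul_left h1
    obtain ⟨q, hq⟩ := h3
    have h1 : IsSumThreeSq q := isSumThreeSq_of_mod (by omega) (by omega) (by omega)
    convert h1.sq_mul (2 ^ a) using 1
    rw [← pow_mul, mul_comm a 2, pow_mul]
    rw [hq] at h
    zify at h
    norm_num
    linarith
  obtain ⟨x, y, z, hn⟩ := h5.exists_five_mul_sq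
  exact ⟨x, -(2 * x), y, z, by rw [hn]; ring, by ring⟩

theorem theorem1p5 :
    (∀ l : ℤ, l = 1 ∨ l = 2 → ∀ m : ℕ, m = 2 ∨ m = 3 → ∀ n : ℕ,
      ∃ x y z w : ℤ, (n : ℤ) = x ^ 2 + y ^ 2 + z ^ 2 + w ^ 2 ∧
        ∃ r : ℕ, x + 2 * y + 3 * z - w = l * (r : ℤ) ^ m) ∧
    (∀ n : ℕ, ∃ w x y z : ℤ, (n : ℤ) = w ^ 2 + x ^ 2 + y ^ 2 + z ^ 2 ∧
        w * (x + 2 * y + 3 * z - w) = 0 ∧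
        IsSquare (w * (x + 2 * y + 3 * z))) ∧
    (∀ n : ℕ, ∃ w x y z : ℤ, w ^ 2 + x ^ 2 + y ^ 2 + z ^ 2 = (n : ℤ) ∧
        (2 * w + x) * (2 * w + x - y - 3 * z) = 0 ∧
        IsSquare ((10 * w + 5 * x) ^ 2 + (12 * y + 36 * z) ^ 2)) := by
  refine ⟨fun l hl m hm n => exists_four_sq_linear_eq_mul_pow hl hm n, fun n => ?_, fun n => ?_⟩
  · obtain ⟨w, x, y, z, hn, h⟩ := exists_four_sq_mul_eq_zero n
    exact ⟨w, x, y, z, hn, h, w, by linarith⟩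
  · obtain ⟨w, x, y, z, hn, h⟩ := exists_four_sq_mul_eq_zero' n
    refine ⟨w, x, y, z, hn, h, ?_⟩
    rcases mul_eq_zero.1 h with h0 | h0
    · exact ⟨12 * y + 36 * z, by linear_combination 25 * (2 * w + x) * h0⟩
    · -- `5 ^ 2 + 12 ^ 2 = 13 ^ 2`
      exact ⟨13 * (2 * w + x),
        by linear_combination (-144) * (2 * w + x + y + 3 * z) * h0⟩
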